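/- Let $k$ be a field. A *rational pointed fan* $\Sigma$ in $\mathbb{R}^d$ is a nonempty collection of convex cones, each generated by finitely many rational vectors and having $\{0\}$ as a face, such that every face of a cone of $\Sigma$ belongs to $\Sigma$ and any two cones of $\Sigma$ intersect in a common face; here a face of a cone $C$ is a set $\{x\in C : l(x)=0\}$ with $l$ a linear form that is nonnegative on $C$. A *monoidal complex* $\mathcal{M}$ supported on $\Sigma$ is a family of finitely generated submonoids $M_C\subseteq C\cap\mathbb{Z}^d$ $(C\in\Sigma)$ such that $M_C$ generates the cone $C$, and $M_D=M_C\cap D$ whenever $C,D\in\Sigma$ and $D\subseteq C$. Put $|\mathcal{M}|=\bigcup_{C\in\Sigma}M_C$. The *toric face ring* $k[\mathcal{M}]$ is the $\mathbb{Z}^d$-graded $k$-algebra with $k$-basis $\{t^a : a\in|\mathcal{M}|\}$, where $t^a$ has degree $a$, and with $t^a t^b=t^{a+b}$ if $a,b\in M_C$ for some $C\in\Sigma$ and $t^at^b=0$ otherwise. A *subfan* $\Gamma$ of $\Sigma$ is a rational pointed fan all of whose cones belong to $\Sigma$; $\mathcal{M}_\Gamma=(M_D)_{D\in\Gamma}$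 is the induced monoidal complex on it. The subfan $\Gamma$ is *restricted* if, whenever finitely many points of $\bigcup_{D\in\Gamma}D$ lie in a common cone of $\Sigma$, they lie in a common cone of $\Gamma$. **Proposition 4.5.** Let $\mathcal{M}$ be a monoidal complex supported on a rational pointed fan $\Sigma$ in $\mathbb{R}^d$, and let $A$ be a commutative $\mathbb{Z}^d$-graded ring. Then $A$ is a $\mathbb{Z}^d$-graded algebra retract of $k[\mathcal{M}]$, that is, there are graded ring homomorphisms $\theta\colon A\to k[\mathcal{M}]$ and $\varphi\colon k[\mathcal{M}]\to A$ with $\varphi\circ\theta=\mathrm{id}_A$, if and only if there is a restricted subfan $\Gamma$ of $\Sigma$ such that $A\cong k[\mathcal{M}_\Gamma]$ as $\mathbb{Z}^d$-graded rings. If $A$ is a commutative $\mathbb{Z}^d$-graded $k$-algebra, the same equivalence holds with $\theta$, $\varphi$ and the isomorphism required to be homomorphisms of graded $k$-algebras. -/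

import Mathlib

/-! ### Rational pointed fans -/

/-- The inclusion `ℤ^d ⊆ ℝ^d`. -/
def latticePoint {d : ℕ} (a : Fin d → ℤ) : Fin d → ℝ := fun i => (a i : ℝ)

/-- `F` is a face of the cone `C` in `ℝ^d`: it is the intersection of `C` with a hyperplane `l = 0`
such that `C` lies in the half-space `l ≥ 0`. As usual `l = 0` is allowed, so that `C` is a face of
itself. (A hyperplane that meets a cone and has the cone on one side passes through the origin.) -/
def IsConeFace {d : ℕ} (F C : PointedCone ℝ (Fin d → ℝ)) : Prop :=
  ∃ l : (Fin d → ℝ) →ₗ[ℝ] ℝ, (∀ x ∈ C, 0 ≤ l x) ∧ ∀ x, x ∈ F ↔ x ∈ C ∧ l x = 0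

/-- A cone generated by finitely many rational vectors. -/
def IsRationalCone {d : ℕ} (C : PointedCone ℝ (Fin d → ℝ)) : Prop :=
  ∃ s : Set (Fin d → ℚ), s.Finite ∧
    C = PointedCone.hull ℝ ((fun (v : Fin d → ℚ) (i : Fin d) => (v i : ℝ)) '' s)

/-- A rational pointed fan in `ℝ^d`. (All cones contain the origin, hence no two of them have
empty intersection. Mathlib's `PointedCone` only means a convex cone containing `0`; that the cones
are pointed in the sense of convex geometry is the field `pointed`.) -/
structure RationalPointedFan (d : ℕ) where
  /-- the cones of the fan -/
  cones : Set (PointedCone ℝ (Fin d → ℝ))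
  nonempty : cones.Nonempty
  rational : ∀ C ∈ cones, IsRationalCone C
  pointed : ∀ C ∈ cones, IsConeFace ⊥ C
  face_mem : ∀ C ∈ cones, ∀ C', IsConeFace C' C → C' ∈ cones
  inter_face : ∀ C ∈ cones, ∀ D ∈ cones, IsConeFace (C ⊓ D) C ∧ IsConeFace (C ⊓ D) D

namespace RationalPointedFan

/-- The support `|Γ|` of a fan: the union of its cones. -/
def support {d : ℕ} (Γ : RationalPointedFan d) : Set (Fin d → ℝ) :=
  {x | ∃ D ∈ Γ.cones, x ∈ D}

/-- `Γ` is a subfan of `F`: a fan all of whose cones belong to `F`. -/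
def IsSubfan {d : ℕ} (Γ F : RationalPointedFan d) : Prop := Γ.cones ⊆ F.cones

/-- `Γ` is a restricted subfan of `F`: a subfan such that any finitely many points of `|Γ|` that lie
in a common cone of `F` lie in a common cone of `Γ`. -/
structure IsRestrictedSubfan {d : ℕ} (Γ F : RationalPointedFan d) : Prop where
  isSubfan : Γ.IsSubfan F
  exists_cone : ∀ s : Finset (Fin d → ℝ), (∀ x ∈ s, x ∈ Γ.support) →
    (∃ C ∈ F.cones, ∀ x ∈ s, x ∈ C) → ∃ D ∈ Γ.cones, ∀ x ∈ s, x ∈ D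

end RationalPointedFan

/-! ### Monoidal complexes -/

/-- A monoidal complex supported on the fan `F`: an affine monoid `M_C ⊆ C ∩ ℤ^d` generating the
cone `C`, for every cone `C` of `F`, with `M_D = M_C ∩ D` whenever `D ⊆ C`. -/
structure MonoidalComplex {d : ℕ} (F : RationalPointedFan d) where
  /-- the affine monoid `M_C` -/
  monoid : {C : PointedCone ℝ (Fin d → ℝ) // C ∈ F.cones} → AddSubmonoid (Fin d → ℤ)
  fg : ∀ C, (monoid C).FG
  mem_cone : ∀ C, ∀ a ∈ monoid C, latticePoint a ∈ C.1
  generates : ∀ C, PointedCone.hull ℝ (latticePoint '' (monoid C : Set (Fin d → ℤ))) = C.1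
  compatible : ∀ C D, D.1 ≤ C.1 → ∀ a, a ∈ monoid D ↔ a ∈ monoid C ∧ latticePoint a ∈ D.1

namespace MonoidalComplex

variable {d : ℕ} {F Γ : RationalPointedFan d}

/-- The induced monoidal subcomplex `M_Γ` on a subfan `Γ`. -/
def restrict (M : MonoidalComplex F) (h : Γ.IsSubfan F) : MonoidalComplex Γ where
  monoid C := M.monoid ⟨C.1, h C.2⟩
  fg _ := M.fg _
  mem_cone _ := M.mem_cone _
  generates _ := M.generates _
  compatible C D hDC := M.compatible ⟨C.1, h C.2⟩ ⟨D.1, h D.2⟩ hDC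

/-- `|M|`, the union of the monoids `M_C`. -/
def support (M : MonoidalComplex F) : Set (Fin d → ℤ) := {a | ∃ C, a ∈ M.monoid C}

/-- `a` and `b` are contained in `M_C` for some cone `C` of the fan. -/
def Compat (M : MonoidalComplex F) (a b : Fin d → ℤ) : Prop :=
  ∃ C, a ∈ M.monoid C ∧ b ∈ M.monoid C

theorem Compat.add_mem {M : MonoidalComplex F} {a b : Fin d → ℤ} (h : M.Compat a b) :
    a + b ∈ M.support :=
  let ⟨C, ha, hb⟩ := h
  ⟨C, AddSubmonoid.add_mem _ ha hb⟩

theorem Compat.symm {M : MonoidalComplex F} {a b : Fin d → ℤ} (h : M.Compat a b) :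
    M.Compat b a :=
  let ⟨C, ha, hb⟩ := h
  ⟨C, hb, ha⟩

theorem zero_mem_support (M : MonoidalComplex F) : 0 ∈ M.support :=
  ⟨⟨F.nonempty.some, F.nonempty.some_mem⟩, zero_mem _⟩

theorem mem_monoid_of_mem_cone (M : MonoidalComplex F) {a : Fin d → ℤ}
    {C D : {C : PointedCone ℝ (Fin d → ℝ) // C ∈ F.cones}}
    (ha : a ∈ M.monoid C) (haD : latticePoint a ∈ D.1) : a ∈ M.monoid D := by
  have hE := F.face_mem C.1 C.2 _ (F.inter_face C.1 C.2 D.1 D.2).1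
  have h1 := (M.compatible C ⟨_, hE⟩ inf_le_left a).2 ⟨ha, M.mem_cone C a ha, haD⟩
  exact ((M.compatible D ⟨_, hE⟩ inf_le_right a).1 h1).1

/-- If `a, b ∈ M_C` and `a + b` lies in a cone `D` of the fan, then `a, b ∈ M_D`. -/
theorem mem_of_add_mem (M : MonoidalComplex F) {a b : Fin d → ℤ}
    {C D : {C : PointedCone ℝ (Fin d → ℝ) // C ∈ F.cones}}
    (ha : a ∈ M.monoid C) (hb : b ∈ M.monoid C) (hab : latticePoint (a + b) ∈ D.1) :
    a ∈ M.monoid D ∧ b ∈ M.monoid D := by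
  obtain ⟨l, hl, hF⟩ := (F.inter_face C.1 C.2 D.1 D.2).1
  have hadd : latticePoint (a + b) = latticePoint a + latticePoint b := by
    ext i; simp [latticePoint]
  have h0 := ((hF _).1 ⟨M.mem_cone C _ (add_mem ha hb), hab⟩).2
  rw [hadd, map_add] at h0
  have h1 := hl _ (M.mem_cone C a ha)
  have h2 := hl _ (M.mem_cone C b hb)
  have ha' := ((hF (latticePoint a)).2 ⟨M.mem_cone C a ha, by linarith⟩).2
  have hb' := ((hF (latticePoint b)).2 ⟨M.mem_cone C b hb, by linarith⟩).2
  exact ⟨M.mem_monoid_of_mem_cone ha ha', M.mem_monoid_of_mem_cone hb hb'⟩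

theorem compat_assoc (M : MonoidalComplex F) (a b c : Fin d → ℤ) :
    (M.Compat a b ∧ M.Compat (a + b) c) ↔ (M.Compat b c ∧ M.Compat a (b + c)) := by
  constructor
  · rintro ⟨⟨C, ha, hb⟩, ⟨D, hab, hc⟩⟩
    obtain ⟨ha', hb'⟩ := M.mem_of_add_mem ha hb (M.mem_cone D _ hab)
    exact ⟨⟨D, hb', hc⟩, ⟨D, ha', add_mem hb' hc⟩⟩
  · rintro ⟨⟨C, hb, hc⟩, ⟨D, ha, hbc⟩⟩
    obtain ⟨hb', hc'⟩ := M.mem_of_add_mem hb hc (M.mem_cone D _ hbc)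
    exact ⟨⟨D, ha, hb'⟩, ⟨D, add_mem ha hb', hc'⟩⟩

end MonoidalComplex

/-! ### Toric face rings -/

/-- The toric face ring `k[M]`: as a `k`-vector space it has the basis `t^a`, `a ∈ |M|`. -/
def ToricFaceRing (k : Type*) [Field k] {d : ℕ} {F : RationalPointedFan d}
    (M : MonoidalComplex F) : Type _ :=
  M.support →₀ k

namespace ToricFaceRing

variable {k : Type*} [Field k] {d : ℕ} {F : RationalPointedFan d} {M : MonoidalComplex F}

noncomputable instance : AddCommGroup (ToricFaceRing k M) :=
  inferInstanceAs (AddCommGroup (M.support →₀ k))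

noncomputable instance : Module k (ToricFaceRing k M) :=
  inferInstanceAs (Module k (M.support →₀ k))

/-- The basis `(t^a)_{a ∈ |M|}` of `k[M]`. -/
noncomputable def basis (k : Type*) [Field k] {d : ℕ} {F : RationalPointedFan d}
    (M : MonoidalComplex F) : Module.Basis M.support k (ToricFaceRing k M) :=
  Module.Basis.ofRepr (LinearEquiv.refl k (M.support →₀ k))

open Classical in
/-- The product `t^a * t^b`: it is `t^(a+b)` if `a` and `b` are contained in a common `M_C`, and `0`
otherwise. -/
noncomputable def basisMul (k : Type*) [Field k] {d : ℕ} {F : RationalPointedFan d}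
    (M : MonoidalComplex F) (a b : M.support) : ToricFaceRing k M :=
  if h : M.Compat a.1 b.1 then basis k M ⟨a.1 + b.1, h.add_mem⟩ else 0

/-- The multiplication of `k[M]`, as the bilinear extension of `basisMul`. -/
noncomputable def mulLin (k : Type*) [Field k] {d : ℕ} {F : RationalPointedFan d}
    (M : MonoidalComplex F) :
    ToricFaceRing k M →ₗ[k] ToricFaceRing k M →ₗ[k] ToricFaceRing k M :=
  (basis k M).constr k fun a => (basis k M).constr k fun b => basisMul k M a b

noncomputable instance : Mul (ToricFaceRing k M) := ⟨fun x y => mulLin k M x y⟩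

noncomputable instance : One (ToricFaceRing k M) := ⟨basis k M ⟨0, M.zero_mem_support⟩⟩

theorem mul_def (x y : ToricFaceRing k M) : x * y = mulLin k M x y := rfl

theorem one_def : (1 : ToricFaceRing k M) = basis k M ⟨0, M.zero_mem_support⟩ := rfl

theorem basis_mul_basis (a b : M.support) : basis k M a * basis k M b = basisMul k M a b := by
  simp [mul_def, mulLin]

theorem mulLin_comm : mulLin k M = (mulLin k M).flip := by
  refine (basis k M).ext fun a => (basis k M).ext fun b => ?_
  simp only [LinearMap.flip_apply, ← mul_def, basis_mul_basis, basisMul]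
  by_cases h : M.Compat a.1 b.1
  · simp [h, h.symm, add_comm]
  · have h' : ¬ M.Compat b.1 a.1 := fun h' => h h'.symm
    simp [h, h']

theorem mulLin_one : mulLin k M 1 = LinearMap.id := by
  refine (basis k M).ext fun b => ?_
  have h : M.Compat 0 b.1 := let ⟨C, hC⟩ := b.2; ⟨C, zero_mem _, hC⟩
  simp [← mul_def, one_def, basis_mul_basis, basisMul, h]

theorem basis_mul_assoc (a b c : M.support) :
    basis k M a * basis k M b * basis k M c = basis k M a * (basis k M b * basis k M c) := by
  have key := M.compat_assoc a.1 b.1 c.1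
  simp only [basis_mul_basis, basisMul]
  by_cases h1 : M.Compat a.1 b.1 <;> by_cases h2 : M.Compat b.1 c.1 <;>
    simp only [h1, h2, dite_true, dite_false, basis_mul_basis, basisMul, true_and, false_and,
      iff_false, false_iff] at key ⊢
  · by_cases h : M.Compat a.1 (b.1 + c.1)
    · simp [h, key.2 h, add_assoc]
    · have h' : ¬ M.Compat (a.1 + b.1) c.1 := fun h' => h (key.1 h')
      simp [h, h']
  · simp [key, mul_def]
  · simp [key, mul_def]
  · simp [mul_def]

theorem mulLin_assoc (x y z : ToricFaceRing k M) :
    mulLin k M (mulLin k M x y) z = mulLin k M x (mulLin k M y z) := by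
  have h1 : ∀ (a b : M.support) (z : ToricFaceRing k M),
      mulLin k M (mulLin k M (basis k M a) (basis k M b)) z =
        mulLin k M (basis k M a) (mulLin k M (basis k M b) z) := fun a b =>
    LinearMap.congr_fun (f := mulLin k M (mulLin k M (basis k M a) (basis k M b)))
      (g := mulLin k M (basis k M a) ∘ₗ mulLin k M (basis k M b))
      ((basis k M).ext fun c => basis_mul_assoc a b c)
  have h2 : ∀ (a : M.support) (y z : ToricFaceRing k M),
      mulLin k M (mulLin k M (basis k M a) y) z =
        mulLin k M (basis k M a) (mulLin k M y z) := fun a y z =>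
    LinearMap.congr_fun (f := (mulLin k M).flip z ∘ₗ mulLin k M (basis k M a))
      (g := mulLin k M (basis k M a) ∘ₗ (mulLin k M).flip z)
      ((basis k M).ext fun b => h1 a b z) y
  exact LinearMap.congr_fun (f := (mulLin k M).flip z ∘ₗ (mulLin k M).flip y)
      (g := (mulLin k M).flip (mulLin k M y z))
      ((basis k M).ext fun a => h2 a y z) x

theorem mulLin_comm_apply (x y : ToricFaceRing k M) : mulLin k M x y = mulLin k M y x :=
  LinearMap.congr_fun₂ (mulLin_comm (k := k) (M := M)) x y

noncomputable instance : CommRing (ToricFaceRing k M) where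
  __ := (inferInstance : AddCommGroup (ToricFaceRing k M))
  left_distrib x y z := map_add (mulLin k M x) y z
  right_distrib x y z := (mulLin k M).map_add₂ x y z
  zero_mul x := (mulLin k M).map_zero₂ x
  mul_zero x := map_zero (mulLin k M x)
  mul_assoc := mulLin_assoc
  one_mul x := LinearMap.congr_fun (mulLin_one (k := k) (M := M)) x
  mul_one x := (mulLin_comm_apply x 1).trans
    (LinearMap.congr_fun (mulLin_one (k := k) (M := M)) x)
  mul_comm := mulLin_comm_apply

noncomputable instance : Algebra k (ToricFaceRing k M) :=
  Algebra.ofModule (fun r x y => (mulLin k M).map_smul₂ r x y)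
    (fun r x y => map_smul (mulLin k M x) r y)

/-- The `ℤ^d`-grading of `k[M]`: the component of degree `n` is spanned by `t^n` if `n ∈ |M|` and
it is `0` otherwise. -/
noncomputable def grading (k : Type*) [Field k] {d : ℕ} {F : RationalPointedFan d}
    (M : MonoidalComplex F) (n : Fin d → ℤ) : Submodule k (ToricFaceRing k M) :=
  Submodule.span k {x | ∃ a : M.support, a.1 = n ∧ x = basis k M a}

theorem basis_mem_grading (a : M.support) : basis k M a ∈ grading k M a.1 :=
  Submodule.subset_span ⟨a, rfl, rfl⟩

theorem basisMul_mem_grading (a b : M.support) : basisMul k M a b ∈ grading k M (a.1 + b.1) := by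
  unfold basisMul
  split_ifs with h
  · exact basis_mem_grading (k := k) (M := M) ⟨a.1 + b.1, h.add_mem⟩
  · exact zero_mem _

instance : SetLike.GradedMonoid (grading k M) where
  one_mem := basis_mem_grading (k := k) (M := M) ⟨0, M.zero_mem_support⟩
  mul_mem m n x y hx hy := by
    have h := Submodule.mul_mem_mul hx hy
    rw [grading, grading, Submodule.span_mul_span] at h
    refine Submodule.span_le.2 ?_ h
    rintro _ ⟨_, ⟨a, rfl, rfl⟩, _, ⟨b, rfl, rfl⟩, rfl⟩
    simp only [SetLike.mem_coe, basis_mul_basis]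
    exact basisMul_mem_grading a b

/-- The decomposition of an element of `k[M]` into homogeneous components. -/
noncomputable def decomposeLin (k : Type*) [Field k] {d : ℕ} {F : RationalPointedFan d}
    (M : MonoidalComplex F) :
    ToricFaceRing k M →ₗ[k] DirectSum (Fin d → ℤ) fun n => grading k M n :=
  (basis k M).constr k fun a =>
    DirectSum.lof k (Fin d → ℤ) (fun n => grading k M n) a.1 ⟨basis k M a, basis_mem_grading a⟩

noncomputable instance : GradedAlgebra (grading k M) where
  toDecomposition := DirectSum.Decomposition.ofLinearMap _ (decomposeLin k M)
    ((basis k M).ext fun a => by simp [decomposeLin])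
    (by
      refine DirectSum.linearMap_ext _ fun n => ?_
      ext ⟨x, hx⟩ : 1
      simp only [LinearMap.comp_apply, DirectSum.coeLinearMap_lof, LinearMap.id_apply]
      induction hx using Submodule.span_induction with
      | mem x h =>
        obtain ⟨a, rfl, rfl⟩ := h
        simp [decomposeLin]
      | zero =>
        rw [map_zero]
        exact (map_zero (DirectSum.lof k (Fin d → ℤ) (fun n => grading k M n) n)).symm
      | add x y hx hy h1 h2 =>
        rw [map_add, h1, h2, ← map_add]; rfl
      | smul r x hx h =>
        rw [map_smul, h, ← map_smul]; rfl)

end ToricFaceRing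

/-! ### Graded algebra retracts -/

section GradedRetracts

variable {ι A B : Type*} [DecidableEq ι] [AddMonoid ι] [CommRing A] [CommRing B]

/-- The graded ring `A` is a graded algebra retract of the graded ring `B`: there are graded ring
homomorphisms `θ : A → B` and `φ : B → A` with `φ ∘ θ = id` (in particular, `θ` is injective). -/
def IsGradedRetract {σ τ : Type*} [SetLike σ A] [SetLike τ B] (𝒜 : ι → σ) (ℬ : ι → τ) : Prop :=
  ∃ (θ : 𝒜 →+*ᵍ ℬ) (φ : ℬ →+*ᵍ 𝒜), ∀ x : A, φ (θ x) = x

/-- `A ≅ B` as graded rings. -/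
def IsGradedIso {σ τ : Type*} [SetLike σ A] [SetLike τ B] (𝒜 : ι → σ) (ℬ : ι → τ) : Prop :=
  ∃ e : A ≃+* B, ∀ n x, e x ∈ ℬ n ↔ x ∈ 𝒜 n

/-- The version of `IsGradedRetract` for graded `k`-algebras: all maps are `k`-linear. -/
def IsGradedRetractOver (k : Type*) [Field k] [Algebra k A] [Algebra k B]
    (𝒜 : ι → Submodule k A) (ℬ : ι → Submodule k B) [GradedAlgebra 𝒜] [GradedAlgebra ℬ] : Prop :=
  ∃ (θ : 𝒜 →ₐᵍ[k] ℬ) (φ : ℬ →ₐᵍ[k] 𝒜), ∀ x : A, φ (θ x) = x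

/-- `A ≅ B` as graded `k`-algebras. -/
def IsGradedIsoOver (k : Type*) [Field k] [Algebra k A] [Algebra k B]
    (𝒜 : ι → Submodule k A) (ℬ : ι → Submodule k B) : Prop :=
  ∃ e : A ≃ₐ[k] B, ∀ n x, e x ∈ ℬ n ↔ x ∈ 𝒜 n

end GradedRetracts

/-!
A retract `A` of `k[M]` is the image of the idempotent graded endomorphism `ε = θ ∘ φ`. The graded
pieces of `k[M]` have dimension at most one, so `ε` sends every monomial `t^a` to `t^a` or to `0`,
and as `ε` is multiplicative, the exponents it fixes form a face of every monoid `M_C`. A face of a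
finitely generated monoid of lattice points is cut out by a linear form (Gordan's theorem of the
alternative), so it equals `M_D` for a face `D` of `C`. These cones `D` form a restricted subfan
`Γ`, and `ε` factors as `k[M] → k[M_Γ] → k[M]`, whence `A ≅ k[M_Γ]`. In degree `0` the ring `k[M]`
is the field `k`, so an idempotent graded ring endomorphism is automatically `k`-linear.
-/

section PositiveFunctionals

variable {G K ι : Type*} [AddCommGroup G]

theorem exists_addMonoidHom_apply_eq_one [DivisionRing K] [CharZero K] {a : G}
    (ha : ¬ IsOfFinAddOrder a) : ∃ l : G →+ K, l a = 1 := by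
  have hinj : Function.Injective (zmultiplesHom G a) :=
    injective_zsmul_iff_not_isOfFinAddOrder.2 ha
  obtain ⟨l, hl⟩ := (Module.Baer.of_divisible K).extension_property_addMonoidHom
    (zmultiplesHom G a) hinj (Int.castAddHom K)
  exact ⟨l, by simpa using DFunLike.congr_fun hl 1⟩

theorem not_isOfFinAddOrder_of_neg_notMem {N : AddSubmonoid G} {a : G} (ha : a ∈ N)
    (hneg : -a ∉ N) : ¬ IsOfFinAddOrder a := fun hfin => by
  have hmul : -a ∈ AddSubmonoid.multiples a :=
    hfin.mem_multiples_iff_mem_zmultiples.2 (neg_mem (AddSubgroup.mem_zmultiples a))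
  exact hneg (AddSubmonoid.multiples_le.2 ha hmul)

variable [Field K] [LinearOrder K] [IsStrictOrderedRing K]

-- A large multiple of `l` outweighs the values at `v` of a functional that is positive at `a`.
theorem exists_addMonoidHom_pos_of_quotient {a : G} (ha : ¬ IsOfFinAddOrder a) {s : Finset ι}
    {v : ι → G} (l : G ⧸ AddSubgroup.zmultiples a →+ K) (hl : ∀ i ∈ s, 0 < l (v i)) :
    ∃ l' : G →+ K, 0 < l' a ∧ ∀ i ∈ s, 0 < l' (v i) := by
  obtain ⟨m, hm⟩ := exists_addMonoidHom_apply_eq_one (K := K) ha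
  have hlarge : ∀ᶠ r : K in Filter.atTop, ∀ i ∈ s, 0 < r * l (v i) + m (v i) :=
    (Filter.eventually_all_finset s).2 fun i hi =>
      (Filter.tendsto_atTop_add_const_right _ _
        (Filter.tendsto_id.atTop_mul_const (hl i hi))).eventually_gt_atTop 0
  obtain ⟨r, hr⟩ := hlarge.exists
  have hla : l (QuotientAddGroup.mk a) = 0 := by
    rw [(QuotientAddGroup.eq_zero_iff a).2 (AddSubgroup.mem_zmultiples a), map_zero]
  exact ⟨(AddMonoidHom.mulLeft r).comp (l.comp (QuotientAddGroup.mk' _)) + m,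
    by simp [hla, hm], by simpa using hr⟩

theorem exists_add_mem_of_neg_mk_mem_closure {H : AddSubgroup G} {g : G} {t : Set G}
    (hg : -(g : G ⧸ H) ∈ AddSubmonoid.closure (QuotientAddGroup.mk '' t)) :
    ∃ x ∈ AddSubmonoid.closure t, g + x ∈ H := by
  obtain ⟨x, hx, hxg⟩ := (AddMonoidHom.map_mclosure (QuotientAddGroup.mk' H) t).ge hg
  exact ⟨x, hx, by simpa only [neg_neg] using QuotientAddGroup.eq.1 hxg.symm⟩

theorem exists_pos_zsmul_eq_of_neg_mem_closure_quotient {a g : G} {t : Set G}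
    (hg : -(g : G ⧸ AddSubgroup.zmultiples a) ∈ AddSubmonoid.closure (QuotientAddGroup.mk '' t))
    (hneg : -g ∉ AddSubmonoid.closure (insert a t)) :
    ∃ x ∈ AddSubmonoid.closure t, ∃ z : ℤ, 0 < z ∧ g + x = z • a := by
  obtain ⟨x, hx, z, hz : z • a = g + x⟩ := exists_add_mem_of_neg_mk_mem_closure hg
  refine ⟨x, hx, z, ?_, hz.symm⟩
  by_contra! hz0
  have hx' : x ∈ AddSubmonoid.closure (insert a t) :=
    AddSubmonoid.closure_mono (Set.subset_insert a t) hx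
  have ha : a ∈ AddSubmonoid.closure (insert a t) :=
    AddSubmonoid.subset_closure (Set.mem_insert a t)
  have hg' : -g = x + z.natAbs • a := by
    rw [← natCast_zsmul, Int.ofNat_natAbs_of_nonpos hz0, neg_smul, hz]
    abel
  exact hneg (hg' ▸ add_mem hx' (nsmul_mem ha _))

theorem exists_addMonoidHom_pos {s : Finset ι} {v : ι → G}
    (hv : ∀ i ∈ s, -v i ∉ AddSubmonoid.closure (v '' s)) :
    ∃ l : G →+ K, ∀ i ∈ s, 0 < l (v i) := by
  classical
  induction s using Finset.induction_on generalizing G with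
  | empty => exact ⟨0, by simp⟩
  | insert a s _ ih =>
    rw [Finset.coe_insert, Set.image_insert_eq] at hv
    have hva : -v a ∉ AddSubmonoid.closure (insert (v a) (v '' s)) := hv a (s.mem_insert_self a)
    have hvs : ∀ i ∈ s, -v i ∉ AddSubmonoid.closure (insert (v a) (v '' s)) := fun i hi =>
      hv i (Finset.mem_insert_of_mem hi)
    simp only [Finset.forall_mem_insert]
    by_cases hquot : ∀ i ∈ s, -(v i : G ⧸ AddSubgroup.zmultiples (v a)) ∉
        AddSubmonoid.closure ((fun j => (v j : G ⧸ AddSubgroup.zmultiples (v a))) '' s)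
    · obtain ⟨l, hl⟩ := ih hquot
      exact exists_addMonoidHom_pos_of_quotient (not_isOfFinAddOrder_of_neg_notMem
        (AddSubmonoid.subset_closure (Set.mem_insert _ _)) hva) l hl
    · push Not at hquot
      obtain ⟨i, hi, hneg⟩ := hquot
      rw [← Set.image_image] at hneg
      obtain ⟨x, hx, z, hz, hsum⟩ := exists_pos_zsmul_eq_of_neg_mem_closure_quotient hneg (hvs i hi)
      obtain ⟨l, hl⟩ := ih fun j hj hmem =>
        hvs j hj (AddSubmonoid.closure_mono (Set.subset_insert _ _) hmem)
      have hlx : 0 ≤ l x := by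
        have hle : AddSubmonoid.closure (v '' s) ≤ (AddSubmonoid.nonneg K).comap l := by
          rw [AddSubmonoid.closure_le]
          rintro _ ⟨j, hj, rfl⟩
          exact (hl j hj).le
        exact hle hx
      have hza : 0 < z • l (v a) := by
        rw [← map_zsmul, ← hsum, map_add]
        exact add_pos_of_pos_of_nonneg (hl i hi) hlx
      exact ⟨l, (smul_pos_iff_of_pos_left hz).1 hza, hl⟩

/-- A face of the additive monoid `N`: a submonoid `T` such that a sum of two elements of
`N` lies in `T` only if both summands do. -/
structure IsMonoidFace (T N : AddSubmonoid G) : Prop where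
  le : T ≤ N
  mem_of_add_mem : ∀ a ∈ N, ∀ b ∈ N, a + b ∈ T → a ∈ T

theorem exists_add_mem_of_mem_addSubgroup_closure {T : AddSubmonoid G} {x : G}
    (hx : x ∈ AddSubgroup.closure (T : Set G)) :
    ∃ t ∈ T, x + t ∈ T := by
  induction hx using AddSubgroup.closure_induction with
  | mem x hx => exact ⟨0, zero_mem T, by rwa [add_zero]⟩
  | zero => exact ⟨0, zero_mem T, by rw [add_zero]; exact zero_mem T⟩
  | add x y _ _ hx hy =>
    obtain ⟨t, ht, hxt⟩ := hx
    obtain ⟨u, hu, hyu⟩ := hy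
    exact ⟨t + u, add_mem ht hu, add_add_add_comm x y t u ▸ add_mem hxt hyu⟩
  | neg x _ hx =>
    obtain ⟨t, ht, hxt⟩ := hx
    exact ⟨x + t, hxt, by rwa [neg_add_cancel_left]⟩

theorem IsMonoidFace.neg_mk_notMem {T N : AddSubmonoid G} (hT : IsMonoidFace T N) {s : Set G}
    (hs : s ⊆ N) {g : G} (hgN : g ∈ N) (hgT : g ∉ T) :
    -(g : G ⧸ AddSubgroup.closure (T : Set G)) ∉ AddSubmonoid.closure ((↑) '' s) := by
  intro hg
  obtain ⟨x, hx, hgx⟩ := exists_add_mem_of_neg_mk_mem_closure hg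
  obtain ⟨t, ht, hsum⟩ := exists_add_mem_of_mem_addSubgroup_closure hgx
  have hxN : x ∈ N := AddSubmonoid.closure_le.2 hs hx
  exact hgT (hT.mem_of_add_mem g hgN (x + t) (add_mem hxN (hT.le ht)) (add_assoc g x t ▸ hsum))

theorem IsMonoidFace.exists_addMonoidHom {T N : AddSubmonoid G} (hT : IsMonoidFace T N)
    (hN : N.FG) : ∃ l : G →+ K, ∀ a ∈ N, 0 ≤ l a ∧ (l a = 0 ↔ a ∈ T) := by
  classical
  obtain ⟨s, rfl⟩ := hN
  obtain ⟨l, hl⟩ := exists_addMonoidHom_pos (K := K) (s := s.filter (· ∉ T))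
    (v := ((↑) : G → G ⧸ AddSubgroup.closure (T : Set G))) fun g hg =>
      hT.neg_mk_notMem (fun x hx => AddSubmonoid.subset_closure (Finset.mem_filter.1 hx).1)
        (AddSubmonoid.subset_closure (Finset.mem_filter.1 hg).1) (Finset.mem_filter.1 hg).2
  have hlT : ∀ a ∈ T, l a = 0 := fun a ha => by
    rw [(QuotientAddGroup.eq_zero_iff a).2 (AddSubgroup.subset_closure ha), map_zero]
  suffices hpos : ∀ a ∈ AddSubmonoid.closure (s : Set G), 0 ≤ l a ∧ (l a = 0 → a ∈ T) from
    ⟨l.comp (QuotientAddGroup.mk' _), fun a ha => ⟨(hpos a ha).1, (hpos a ha).2, hlT a⟩⟩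
  intro a ha
  induction ha using AddSubmonoid.closure_induction with
  | mem g hg =>
    by_cases hgT : g ∈ T
    · exact ⟨(hlT g hgT).ge, fun _ => hgT⟩
    · have hlg := hl g (Finset.mem_filter.2 ⟨hg, hgT⟩)
      exact ⟨hlg.le, fun h0 => absurd h0 hlg.ne'⟩
  | zero => exact ⟨(hlT 0 T.zero_mem).ge, fun _ => T.zero_mem⟩
  | add a b _ _ ha hb =>
    rw [QuotientAddGroup.mk_add, map_add]
    refine ⟨add_nonneg ha.1 hb.1, fun h0 => ?_⟩
    obtain ⟨ha0, hb0⟩ := (add_eq_zero_iff_of_nonneg ha.1 hb.1).1 h0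
    exact add_mem (ha.2 ha0) (hb.2 hb0)

end PositiveFunctionals

section LatticePoints

variable {d : ℕ}

theorem exists_linearMap_latticePoint (l : (Fin d → ℤ) →+ ℝ) :
    ∃ L : (Fin d → ℝ) →ₗ[ℝ] ℝ, ∀ a, L (latticePoint a) = l a := by
  refine ⟨Fintype.linearCombination ℝ fun i => l (Pi.single i 1), fun a => ?_⟩
  have hbasis (i : Fin d) : a i • Pi.single (M := fun _ => ℤ) i 1 = Pi.single i (a i) := by
    rw [← Pi.single_smul, smul_eq_mul, mul_one]
  simp_rw [Fintype.linearCombination_apply, latticePoint, Int.cast_smul_eq_zsmul, ← map_zsmul,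
    hbasis, ← map_sum, Finset.univ_sum_single]

end LatticePoints

namespace MonoidalComplex

variable {d : ℕ} {F Γ : RationalPointedFan d}

section Restrict

variable (M : MonoidalComplex F) {a b : Fin d → ℤ}

theorem mem_support_restrict_iff (h : Γ.IsSubfan F) :
    a ∈ (M.restrict h).support ↔ a ∈ M.support ∧ latticePoint a ∈ Γ.support := by
  constructor
  · rintro ⟨D, haD⟩
    exact ⟨⟨⟨D, h D.2⟩, haD⟩, D, D.2, (M.restrict h).mem_cone D a haD⟩
  · rintro ⟨⟨C, haC⟩, D, hD, haD⟩
    exact ⟨⟨D, hD⟩, M.mem_monoid_of_mem_cone (D := ⟨D, h hD⟩) haC haD⟩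

theorem compat_restrict_iff_add_mem (h : Γ.IsSubfan F) :
    (M.restrict h).Compat a b ↔ M.Compat a b ∧ a + b ∈ (M.restrict h).support := by
  constructor
  · refine fun hab => ⟨?_, hab.add_mem⟩
    obtain ⟨D, haD, hbD⟩ := hab
    exact ⟨⟨D, h D.2⟩, haD, hbD⟩
  · rintro ⟨⟨C, haC, hbC⟩, D, habD⟩
    exact ⟨D, M.mem_of_add_mem (D := ⟨D, h D.2⟩) haC hbC ((M.restrict h).mem_cone D _ habD)⟩

theorem compat_restrict_iff (h : Γ.IsRestrictedSubfan F)
    (ha : a ∈ (M.restrict h.isSubfan).support) (hb : b ∈ (M.restrict h.isSubfan).support) :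
    (M.restrict h.isSubfan).Compat a b ↔ M.Compat a b := by
  refine ⟨fun hab => ((M.compat_restrict_iff_add_mem h.isSubfan).1 hab).1, ?_⟩
  rintro ⟨C, haC, hbC⟩
  obtain ⟨D, hD, hab⟩ := h.exists_cone {latticePoint a, latticePoint b}
    (by simpa using ⟨((M.mem_support_restrict_iff h.isSubfan).1 ha).2,
      ((M.mem_support_restrict_iff h.isSubfan).1 hb).2⟩)
    ⟨C, C.2, by simpa using ⟨M.mem_cone C a haC, M.mem_cone C b hbC⟩⟩
  exact ⟨⟨D, hD⟩, M.mem_monoid_of_mem_cone (D := ⟨D, h.isSubfan hD⟩) haC (hab _ (by simp)),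
    M.mem_monoid_of_mem_cone (D := ⟨D, h.isSubfan hD⟩) hbC (hab _ (by simp))⟩

end Restrict

section Faces

variable {M : MonoidalComplex F} {C D : {C : PointedCone ℝ (Fin d → ℝ) // C ∈ F.cones}}

theorem cone_le_of_monoid_le (h : M.monoid C ≤ M.monoid D) : C.1 ≤ D.1 := by
  rw [← M.generates C, ← M.generates D]
  exact Submodule.span_mono (Set.image_mono h)

theorem monoid_le_of_cone_le (h : D.1 ≤ C.1) : M.monoid D ≤ M.monoid C := fun a ha =>
  ((M.compatible C D h a).1 ha).1

theorem exists_cone_of_isMonoidFace {T : AddSubmonoid (Fin d → ℤ)}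
    (hT : IsMonoidFace T (M.monoid C)) :
    ∃ D : {D : PointedCone ℝ (Fin d → ℝ) // D ∈ F.cones}, M.monoid D = T := by
  obtain ⟨l, hl⟩ := hT.exists_addMonoidHom (K := ℝ) (M.fg C)
  obtain ⟨L, hL⟩ := exists_linearMap_latticePoint l
  have hLC : C.1 ≤ (PointedCone.positive ℝ ℝ).comap L := by
    rw [← M.generates C, PointedCone.hull, Submodule.span_le]
    rintro _ ⟨a, ha, rfl⟩
    exact (hl a ha).1.trans_eq (hL a).symm
  have hface : IsConeFace (C.1 ⊓ PointedCone.ofSubmodule L.ker) C.1 := ⟨L, hLC, fun _ => Iff.rfl⟩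
  refine ⟨⟨_, F.face_mem C.1 C.2 _ hface⟩, AddSubmonoid.ext fun a => ?_⟩
  calc a ∈ M.monoid ⟨_, F.face_mem C.1 C.2 _ hface⟩
    _ ↔ a ∈ M.monoid C ∧ latticePoint a ∈ C.1 ∧ L (latticePoint a) = 0 :=
        M.compatible C ⟨_, F.face_mem C.1 C.2 _ hface⟩ inf_le_left a
    _ ↔ a ∈ M.monoid C ∧ a ∈ T := and_congr_right fun ha => by
        rw [hL, (hl a ha).2, and_iff_right (M.mem_cone C a ha)]
    _ ↔ a ∈ T := and_iff_right_of_imp fun ha => hT.le ha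

/-- A face of the monoidal complex `M`: a set of lattice points that meets every `M_C` in a face
of the monoid `M_C`. -/
structure IsFace (M : MonoidalComplex F) (S : Set (Fin d → ℤ)) : Prop where
  zero_mem : 0 ∈ S
  add_mem_iff : ∀ {a b}, M.Compat a b → (a + b ∈ S ↔ a ∈ S ∧ b ∈ S)

namespace IsFace

variable {S : Set (Fin d → ℤ)} (hS : M.IsFace S)
include hS

theorem exists_monoid_eq_inter (C : {C : PointedCone ℝ (Fin d → ℝ) // C ∈ F.cones}) :
    ∃ D : {D : PointedCone ℝ (Fin d → ℝ) // D ∈ F.cones},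
      (M.monoid D : Set (Fin d → ℤ)) = ↑(M.monoid C) ∩ S := by
  let T : AddSubmonoid (Fin d → ℤ) :=
    { carrier := ↑(M.monoid C) ∩ S
      zero_mem' := ⟨(M.monoid C).zero_mem, hS.zero_mem⟩
      add_mem' := fun ha hb =>
        ⟨add_mem ha.1 hb.1, (hS.add_mem_iff ⟨C, ha.1, hb.1⟩).2 ⟨ha.2, hb.2⟩⟩ }
  have hT : IsMonoidFace T (M.monoid C) :=
    ⟨fun a ha => ha.1, fun a ha b hb hab => ⟨ha, ((hS.add_mem_iff ⟨C, ha, hb⟩).1 hab.2).1⟩⟩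
  obtain ⟨D, hD⟩ := exists_cone_of_isMonoidFace hT
  exact ⟨D, congrArg SetLike.coe hD⟩

/-- The subfan formed by the cones `C` with `M_C ⊆ S`, where `S` is a face of `M`. -/
def subfan : RationalPointedFan d where
  cones := {C | ∃ hC : C ∈ F.cones, (M.monoid ⟨C, hC⟩ : Set (Fin d → ℤ)) ⊆ S}
  nonempty := by
    obtain ⟨C, hC⟩ := F.nonempty
    obtain ⟨D, hD⟩ := hS.exists_monoid_eq_inter ⟨C, hC⟩
    exact ⟨D, D.2, hD.trans_subset Set.inter_subset_right⟩
  rational C hC := F.rational C hC.1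
  pointed C hC := F.pointed C hC.1
  face_mem := by
    rintro C ⟨hC, hCS⟩ D hDC
    have hle : D ≤ C := fun x hx => let ⟨_, _, hD⟩ := hDC; ((hD x).1 hx).1
    exact ⟨F.face_mem C hC D hDC, fun a ha => hCS (monoid_le_of_cone_le (C := ⟨C, hC⟩) hle ha)⟩
  inter_face C hC D hD := F.inter_face C hC.1 D hD.1

theorem subfan_isRestrictedSubfan : hS.subfan.IsRestrictedSubfan F := by
  refine ⟨fun C hC => hC.1, ?_⟩
  rintro s hs ⟨C, hC, hsC⟩
  obtain ⟨D, hD⟩ := hS.exists_monoid_eq_inter ⟨C, hC⟩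
  refine ⟨D, ⟨D.2, hD.trans_subset Set.inter_subset_right⟩, fun x hx => ?_⟩
  obtain ⟨E, ⟨hE, hES⟩, hxE⟩ := hs x hx
  have hCE : C ⊓ E ∈ F.cones := F.face_mem C hC _ (F.inter_face C hC E hE).1
  have hmonoid : M.monoid ⟨C ⊓ E, hCE⟩ ≤ M.monoid D := fun a ha =>
    hD.ge ⟨monoid_le_of_cone_le (C := ⟨C, hC⟩) inf_le_left ha,
      hES (monoid_le_of_cone_le (C := ⟨E, hE⟩) inf_le_right ha)⟩
  exact cone_le_of_monoid_le hmonoid ⟨hsC x hx, hxE⟩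

theorem mem_support_restrict_subfan_iff {a : Fin d → ℤ} (ha : a ∈ M.support) :
    a ∈ (M.restrict hS.subfan_isRestrictedSubfan.isSubfan).support ↔ a ∈ S := by
  constructor
  · rintro ⟨⟨D, hD, hDS⟩, haD⟩
    exact hDS haD
  · intro haS
    obtain ⟨C, haC⟩ := ha
    obtain ⟨D, hD⟩ := hS.exists_monoid_eq_inter C
    exact ⟨⟨D, D.2, hD.trans_subset Set.inter_subset_right⟩, hD.ge ⟨haC, haS⟩⟩

end IsFace

end Faces

end MonoidalComplex

namespace ToricFaceRing

variable {k : Type*} [Field k] {d : ℕ} {F F' Γ : RationalPointedFan d} {M : MonoidalComplex F}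
  {M' : MonoidalComplex F'}

open Classical in
/-- The monomial `t^a` for an arbitrary lattice point `a`, with the convention that `t^a = 0`
if `a ∉ |M|`. -/
noncomputable def monomial (k : Type*) [Field k] (M : MonoidalComplex F) (a : Fin d → ℤ) :
    ToricFaceRing k M :=
  if h : a ∈ M.support then basis k M ⟨a, h⟩ else 0

section Monomial

variable {a b n : Fin d → ℤ}

theorem monomial_of_mem (h : a ∈ M.support) : monomial k M a = basis k M ⟨a, h⟩ := dif_pos h

theorem monomial_of_notMem (h : a ∉ M.support) : monomial k M a = 0 := dif_neg h

theorem monomial_zero : monomial k M 0 = 1 := monomial_of_mem M.zero_mem_support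

theorem monomial_ne_zero_iff : monomial k M a ≠ 0 ↔ a ∈ M.support := by
  refine ⟨not_imp_comm.1 monomial_of_notMem, fun h => ?_⟩
  rw [monomial_of_mem h]
  exact (basis k M).ne_zero _

instance : Nontrivial (ToricFaceRing k M) :=
  ⟨1, 0, monomial_zero (k := k) (M := M) ▸ monomial_ne_zero_iff.2 M.zero_mem_support⟩

open Classical in
theorem monomial_mul_monomial :
    monomial k M a * monomial k M b = if M.Compat a b then monomial k M (a + b) else 0 := by
  by_cases ha : a ∈ M.support
  · by_cases hb : b ∈ M.support
    · rw [monomial_of_mem ha, monomial_of_mem hb, basis_mul_basis, basisMul]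
      split_ifs with hab
      · exact (monomial_of_mem hab.add_mem).symm
      · rfl
    · rw [monomial_of_notMem hb, mul_zero, if_neg fun ⟨C, _, hbC⟩ => hb ⟨C, hbC⟩]
  · rw [monomial_of_notMem ha, zero_mul, if_neg fun ⟨C, haC, _⟩ => ha ⟨C, haC⟩]

theorem grading_eq_span (n : Fin d → ℤ) : grading k M n = k ∙ monomial k M n := by
  refine le_antisymm (Submodule.span_le.2 ?_) ((Submodule.span_singleton_le_iff_mem _ _).2 ?_)
  · rintro _ ⟨a, rfl, rfl⟩
    rw [← monomial_of_mem a.2]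
    exact Submodule.mem_span_singleton_self _
  · by_cases hn : n ∈ M.support
    · rw [monomial_of_mem hn]
      exact basis_mem_grading (k := k) (M := M) ⟨n, hn⟩
    · rw [monomial_of_notMem hn]
      exact zero_mem _

theorem mem_grading_iff {x : ToricFaceRing k M} :
    x ∈ grading k M n ↔ ∃ c : k, c • monomial k M n = x := by
  rw [grading_eq_span, Submodule.mem_span_singleton]

theorem monomial_mem_grading : monomial k M n ∈ grading k M n :=
  mem_grading_iff.2 ⟨1, one_smul k _⟩

theorem linearMap_ext {V : Type*} [AddCommMonoid V] [Module k V]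
    {f g : ToricFaceRing k M →ₗ[k] V}
    (h : ∀ a ∈ M.support, f (monomial k M a) = g (monomial k M a)) : f = g :=
  (basis k M).ext fun a => by simpa only [monomial_of_mem a.2] using h a a.2

theorem gradedAlgHom_ext {B : Type*} [CommRing B] [Algebra k B] {ℬ : (Fin d → ℤ) → Submodule k B}
    [GradedAlgebra ℬ] {f g : grading k M →ₐᵍ[k] ℬ}
    (h : ∀ a ∈ M.support, f (monomial k M a) = g (monomial k M a)) : f = g :=
  GradedAlgHom.coe_linearMap_injective <| linearMap_ext fun a ha => h a ha

end Monomial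

section Comparison

/-- The `k`-linear map `k[M] → k[M']` with `t^a ↦ t^a` for `a ∈ |M|`; in particular `t^a ↦ 0` if
`a ∉ |M'|`. -/
noncomputable def comparisonLin (k : Type*) [Field k] (M : MonoidalComplex F)
    (M' : MonoidalComplex F') : ToricFaceRing k M →ₗ[k] ToricFaceRing k M' :=
  (basis k M).constr k fun a => monomial k M' a

theorem comparisonLin_monomial {a : Fin d → ℤ} (ha : a ∈ M.support) :
    comparisonLin k M M' (monomial k M a) = monomial k M' a := by
  rw [monomial_of_mem ha, comparisonLin, Module.Basis.constr_basis]

theorem comparisonLin_mem_grading {n : Fin d → ℤ} {x : ToricFaceRing k M} (hx : x ∈ grading k M n) :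
    comparisonLin k M M' x ∈ grading k M' n := by
  obtain ⟨c, rfl⟩ := mem_grading_iff.1 hx
  rw [map_smul]
  refine Submodule.smul_mem _ c ?_
  by_cases hn : n ∈ M.support
  · rw [comparisonLin_monomial hn]
    exact monomial_mem_grading
  · rw [monomial_of_notMem hn, map_zero]
    exact zero_mem _

theorem comparisonLin_mul
    (h : ∀ a ∈ M.support, ∀ b ∈ M.support, M'.Compat a b ↔ M.Compat a b ∧ a + b ∈ M'.support)
    (x y : ToricFaceRing k M) :
    comparisonLin k M M' (x * y) = comparisonLin k M M' x * comparisonLin k M M' y := by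
  classical
  revert x y
  rw [LinearMap.map_mul_iff]
  refine linearMap_ext fun a ha => linearMap_ext fun b hb => ?_
  simp only [LinearMap.compr₂_apply, LinearMap.mul_apply', LinearMap.compl₂_apply,
    LinearMap.comp_apply, comparisonLin_monomial ha, comparisonLin_monomial hb,
    monomial_mul_monomial]
  by_cases hab : M.Compat a b
  · rw [if_pos hab, comparisonLin_monomial hab.add_mem]
    split_ifs with hab'
    · rfl
    · exact monomial_of_notMem fun hmem => hab' ((h a ha b hb).2 ⟨hab, hmem⟩)
  · rw [if_neg hab, map_zero, if_neg fun hab' => hab ((h a ha b hb).1 hab').1]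

/-- The homomorphism of graded `k`-algebras `k[M] → k[M']` with `t^a ↦ t^a` for `a ∈ |M|`. -/
noncomputable def comparison (k : Type*) [Field k] (M : MonoidalComplex F) (M' : MonoidalComplex F')
    (h : ∀ a ∈ M.support, ∀ b ∈ M.support, M'.Compat a b ↔ M.Compat a b ∧ a + b ∈ M'.support) :
    grading k M →ₐᵍ[k] grading k M' where
  __ := AlgHom.ofLinearMap (comparisonLin k M M')
    (by rw [← monomial_zero, comparisonLin_monomial M.zero_mem_support, monomial_zero])
    (comparisonLin_mul h)
  map_mem := comparisonLin_mem_grading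

/-- The projection `k[M] → k[M_Γ]` onto the toric face ring of a subfan. -/
noncomputable def proj (k : Type*) [Field k] (M : MonoidalComplex F) (h : Γ.IsSubfan F) :
    grading k M →ₐᵍ[k] grading k (M.restrict h) :=
  comparison k M (M.restrict h) fun _ _ _ _ => M.compat_restrict_iff_add_mem h

/-- The inclusion `k[M_Γ] → k[M]` of the toric face ring of a restricted subfan. -/
noncomputable def incl (k : Type*) [Field k] (M : MonoidalComplex F)
    (h : Γ.IsRestrictedSubfan F) : grading k (M.restrict h.isSubfan) →ₐᵍ[k] grading k M :=
  comparison k (M.restrict h.isSubfan) M fun a ha b hb => by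
    rw [M.compat_restrict_iff h ha hb, iff_self_and]
    exact fun hab => hab.add_mem

theorem proj_monomial (h : Γ.IsSubfan F) {a : Fin d → ℤ} (ha : a ∈ M.support) :
    proj k M h (monomial k M a) = monomial k (M.restrict h) a :=
  comparisonLin_monomial ha

variable (h : Γ.IsRestrictedSubfan F)

theorem incl_monomial {a : Fin d → ℤ} (ha : a ∈ (M.restrict h.isSubfan).support) :
    incl k M h (monomial k _ a) = monomial k M a :=
  comparisonLin_monomial ha

theorem proj_incl (x : ToricFaceRing k (M.restrict h.isSubfan)) :
    proj k M h.isSubfan (incl k M h x) = x := by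
  suffices hid : (proj k M h.isSubfan).comp (incl k M h) = .id k _ from DFunLike.congr_fun hid x
  refine gradedAlgHom_ext fun a ha => ?_
  rw [GradedAlgHom.comp_apply, incl_monomial h ha,
    proj_monomial h.isSubfan ((M.mem_support_restrict_iff h.isSubfan).1 ha).1]
  rfl

end Comparison

section Idempotent

theorem map_monomial_eq_self {ε : grading k M →ₐᵍ[k] grading k M} (hε : IsIdempotentElem ε)
    {a : Fin d → ℤ} (ha : ε (monomial k M a) ≠ 0) : ε (monomial k M a) = monomial k M a := by
  obtain ⟨c, hc⟩ := mem_grading_iff.1 (ε.map_mem (monomial_mem_grading (k := k) (M := M) (n := a)))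
  replace hc : c • monomial k M a = ε (monomial k M a) := hc
  have hidem : ε (ε (monomial k M a)) = ε (monomial k M a) := DFunLike.congr_fun hε _
  rw [← hc, map_smul] at hidem
  have hc0 : c ≠ 0 := by
    rintro rfl
    exact ha (by rw [← hc, zero_smul])
  exact smul_right_injective _ hc0 hidem

theorem isFace_of_isIdempotentElem {ε : grading k M →ₐᵍ[k] grading k M}
    (hε : IsIdempotentElem ε) : M.IsFace {a | ε (monomial k M a) ≠ 0} where
  zero_mem := by
    rw [Set.mem_ofPred_eq, monomial_zero, map_one, ← monomial_zero]
    exact monomial_ne_zero_iff.2 M.zero_mem_support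
  add_mem_iff {a b} hab := by
    have hmul : ε (monomial k M a) * ε (monomial k M b) = ε (monomial k M (a + b)) := by
      rw [← map_mul, monomial_mul_monomial, if_pos hab]
    constructor
    · intro hne
      rw [Set.mem_ofPred_eq, ← hmul] at hne
      exact ⟨left_ne_zero_of_mul hne, right_ne_zero_of_mul hne⟩
    · rintro ⟨ha, hb⟩
      rw [Set.mem_ofPred_eq, ← hmul, map_monomial_eq_self hε ha, map_monomial_eq_self hε hb,
        monomial_mul_monomial, if_pos hab]
      exact monomial_ne_zero_iff.2 hab.add_mem

theorem exists_incl_comp_proj_eq {ε : grading k M →ₐᵍ[k] grading k M} (hε : IsIdempotentElem ε) :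
    ∃ (Γ : RationalPointedFan d) (h : Γ.IsRestrictedSubfan F),
      (incl k M h).comp (proj k M h.isSubfan) = ε := by
  have hS := isFace_of_isIdempotentElem hε
  refine ⟨hS.subfan, hS.subfan_isRestrictedSubfan, gradedAlgHom_ext fun a ha => ?_⟩
  rw [GradedAlgHom.comp_apply, proj_monomial _ ha]
  by_cases haΓ : a ∈ (M.restrict hS.subfan_isRestrictedSubfan.isSubfan).support
  · have hne : ε (monomial k M a) ≠ 0 := (hS.mem_support_restrict_subfan_iff ha).1 haΓ
    rw [incl_monomial _ haΓ, map_monomial_eq_self hε hne]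
  · have hzero : ε (monomial k M a) = 0 :=
      not_not.1 (mt (hS.mem_support_restrict_subfan_iff ha).2 haΓ)
    rw [monomial_of_notMem haΓ, map_zero, hzero]

theorem exists_algebraMap_eq_of_mem_grading_zero {x : ToricFaceRing k M} (hx : x ∈ grading k M 0) :
    ∃ c : k, algebraMap k _ c = x := by
  simpa only [mem_grading_iff, monomial_zero, ← Algebra.algebraMap_eq_smul_one] using hx

theorem map_algebraMap_of_isIdempotentElem {ε : grading k M →+*ᵍ grading k M}
    (hε : IsIdempotentElem ε) (c : k) : ε (algebraMap k _ c) = algebraMap k _ c := by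
  obtain ⟨c', hc'⟩ := exists_algebraMap_eq_of_mem_grading_zero
    (ε.map_mem (SetLike.algebraMap_mem_graded (grading k M) c))
  replace hc' : algebraMap k _ c' = ε (algebraMap k _ c) := hc'
  have hidem : ε (algebraMap k _ c') = ε (algebraMap k _ c) :=
    (congrArg ε hc').trans (DFunLike.congr_fun hε (algebraMap k _ c))
  rw [← hc', (ε.toRingHom.comp (algebraMap k _)).injective hidem]

theorem exists_incl_proj_eq_of_isIdempotentElem {ε : grading k M →+*ᵍ grading k M}
    (hε : IsIdempotentElem ε) :
    ∃ (Γ : RationalPointedFan d) (h : Γ.IsRestrictedSubfan F),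
      ∀ x, incl k M h (proj k M h.isSubfan x) = ε x := by
  have hsmul (c : k) (x : ToricFaceRing k M) : ε (c • x) = c • ε x := by
    rw [Algebra.smul_def, map_mul, map_algebraMap_of_isIdempotentElem hε, ← Algebra.smul_def]
  obtain ⟨Γ, h, hΓ⟩ := exists_incl_comp_proj_eq (ε := .mk' ε hsmul)
    (GradedAlgHom.ext fun x => DFunLike.congr_fun hε x)
  exact ⟨Γ, h, DFunLike.congr_fun hΓ⟩

end Idempotent

end ToricFaceRing

section GradedIso

variable {ι A B C : Type*} [CommRing A] [CommRing B] [CommRing C]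

section Ring

variable {σ τ υ : Type*} [SetLike σ A] [SetLike τ B] [SetLike υ C] {𝒜 : ι → σ} {ℬ : ι → τ}
  {𝒞 : ι → υ}

theorem isGradedIso_iff_exists_inverse : IsGradedIso 𝒜 ℬ ↔
    ∃ (f : 𝒜 →+*ᵍ ℬ) (g : ℬ →+*ᵍ 𝒜), (∀ x, g (f x) = x) ∧ ∀ y, f (g y) = y := by
  constructor
  · rintro ⟨e, he⟩
    exact ⟨⟨e, (he _ _).2⟩, ⟨e.symm, fun {n y} hy => (he n _).1 ((e.apply_symm_apply y).symm ▸ hy)⟩,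
      e.symm_apply_apply, e.apply_symm_apply⟩
  · rintro ⟨f, g, hgf, hfg⟩
    exact ⟨.ofRingHom f.toRingHom g.toRingHom (RingHom.ext hfg) (RingHom.ext hgf),
      fun n x => ⟨fun hx => hgf x ▸ g.map_mem hx, f.map_mem⟩⟩

theorem IsGradedIso.isGradedRetract (h : IsGradedIso 𝒜 𝒞) (hr : IsGradedRetract 𝒞 ℬ) :
    IsGradedRetract 𝒜 ℬ := by
  obtain ⟨f, g, hgf, -⟩ := isGradedIso_iff_exists_inverse.1 h
  obtain ⟨θ, φ, hφθ⟩ := hr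
  exact ⟨θ.comp f, g.comp φ, fun x => (congrArg g (hφθ (f x))).trans (hgf x)⟩

theorem isGradedIso_of_comp_eq_comp {θ : 𝒜 →+*ᵍ ℬ} {φ : ℬ →+*ᵍ 𝒜} {i : 𝒞 →+*ᵍ ℬ} {p : ℬ →+*ᵍ 𝒞}
    (hφθ : ∀ x, φ (θ x) = x) (hpi : ∀ z, p (i z) = z) (h : ∀ y, i (p y) = θ (φ y)) :
    IsGradedIso 𝒜 𝒞 :=
  isGradedIso_iff_exists_inverse.2 ⟨p.comp θ, φ.comp i,
    fun x => by simp only [GradedRingHom.comp_apply, h, hφθ],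
    fun z => by simp only [GradedRingHom.comp_apply, ← h, hpi]⟩

end Ring

section Algebra

variable [DecidableEq ι] [AddMonoid ι] {k : Type*} [Field k] [Algebra k A] [Algebra k B]
  [Algebra k C] {𝒜 : ι → Submodule k A} {ℬ : ι → Submodule k B} {𝒞 : ι → Submodule k C}
  [GradedAlgebra 𝒜] [GradedAlgebra ℬ] [GradedAlgebra 𝒞]

theorem isGradedIsoOver_iff_exists_inverse : IsGradedIsoOver k 𝒜 ℬ ↔
    ∃ (f : 𝒜 →ₐᵍ[k] ℬ) (g : ℬ →ₐᵍ[k] 𝒜), (∀ x, g (f x) = x) ∧ ∀ y, f (g y) = y := by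
  constructor
  · rintro ⟨e, he⟩
    exact ⟨⟨e, (he _ _).2⟩, ⟨e.symm, fun {n y} hy => (he n _).1 ((e.apply_symm_apply y).symm ▸ hy)⟩,
      e.symm_apply_apply, e.apply_symm_apply⟩
  · rintro ⟨f, g, hgf, hfg⟩
    exact ⟨.ofAlgHom f.toAlgHom g.toAlgHom (AlgHom.ext hfg) (AlgHom.ext hgf),
      fun n x => ⟨fun hx => hgf x ▸ g.map_mem hx, f.map_mem⟩⟩

theorem IsGradedIsoOver.isGradedRetractOver (h : IsGradedIsoOver k 𝒜 𝒞)
    (hr : IsGradedRetractOver k 𝒞 ℬ) : IsGradedRetractOver k 𝒜 ℬ := by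
  obtain ⟨f, g, hgf, -⟩ := isGradedIsoOver_iff_exists_inverse.1 h
  obtain ⟨θ, φ, hφθ⟩ := hr
  exact ⟨θ.comp f, g.comp φ, fun x => (congrArg g (hφθ (f x))).trans (hgf x)⟩

theorem isGradedIsoOver_of_comp_eq_comp {θ : 𝒜 →ₐᵍ[k] ℬ} {φ : ℬ →ₐᵍ[k] 𝒜} {i : 𝒞 →ₐᵍ[k] ℬ}
    {p : ℬ →ₐᵍ[k] 𝒞} (hφθ : ∀ x, φ (θ x) = x) (hpi : ∀ z, p (i z) = z)
    (h : ∀ y, i (p y) = θ (φ y)) : IsGradedIsoOver k 𝒜 𝒞 :=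
  isGradedIsoOver_iff_exists_inverse.2 ⟨p.comp θ, φ.comp i,
    fun x => by simp only [GradedAlgHom.comp_apply, h, hφθ],
    fun z => by simp only [GradedAlgHom.comp_apply, ← h, hpi]⟩

end Algebra

end GradedIso

namespace ToricFaceRing

variable {k : Type*} [Field k] {d : ℕ} {F Γ : RationalPointedFan d} {M : MonoidalComplex F}
  {A : Type*} [CommRing A]

theorem isGradedRetractOver_restrict (h : Γ.IsRestrictedSubfan F) :
    IsGradedRetractOver k (grading k (M.restrict h.isSubfan)) (grading k M) :=
  ⟨incl k M h, proj k M h.isSubfan, proj_incl h⟩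

theorem isGradedRetract_restrict (h : Γ.IsRestrictedSubfan F) :
    IsGradedRetract (grading k (M.restrict h.isSubfan)) (grading k M) :=
  ⟨(incl k M h).toGradedRingHom, (proj k M h.isSubfan).toGradedRingHom, proj_incl h⟩

theorem exists_isGradedIso_restrict {σ : Type*} [SetLike σ A] {𝒜 : (Fin d → ℤ) → σ}
    (hr : IsGradedRetract 𝒜 (grading k M)) :
    ∃ (Γ : RationalPointedFan d) (h : Γ.IsRestrictedSubfan F),
      IsGradedIso 𝒜 (grading k (M.restrict h.isSubfan)) := by
  obtain ⟨θ, φ, hφθ⟩ := hr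
  have hidem : IsIdempotentElem (θ.comp φ) := GradedRingHom.ext fun x => congrArg θ (hφθ (φ x))
  obtain ⟨Γ, h, hΓ⟩ := exists_incl_proj_eq_of_isIdempotentElem hidem
  exact ⟨Γ, h, isGradedIso_of_comp_eq_comp (i := (incl k M h).toGradedRingHom)
    (p := (proj k M h.isSubfan).toGradedRingHom) hφθ (proj_incl h) hΓ⟩

theorem exists_isGradedIsoOver_restrict [Algebra k A] {𝒜 : (Fin d → ℤ) → Submodule k A}
    [GradedAlgebra 𝒜] (hr : IsGradedRetractOver k 𝒜 (grading k M)) :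
    ∃ (Γ : RationalPointedFan d) (h : Γ.IsRestrictedSubfan F),
      IsGradedIsoOver k 𝒜 (grading k (M.restrict h.isSubfan)) := by
  obtain ⟨θ, φ, hφθ⟩ := hr
  have hidem : IsIdempotentElem (θ.comp φ) := GradedAlgHom.ext fun x => congrArg θ (hφθ (φ x))
  obtain ⟨Γ, h, hΓ⟩ := exists_incl_comp_proj_eq hidem
  exact ⟨Γ, h, isGradedIsoOver_of_comp_eq_comp hφθ (proj_incl h) (DFunLike.congr_fun hΓ)⟩

end ToricFaceRing

theorem proposition4p5 {d : ℕ} (F : RationalPointedFan d) (M : MonoidalComplex F)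
    (k : Type*) [Field k] (A : Type*) [CommRing A] :
    (∀ (𝒜 : (Fin d → ℤ) → AddSubgroup A) [GradedRing 𝒜],
      IsGradedRetract 𝒜 (ToricFaceRing.grading k M) ↔
        ∃ (Γ : RationalPointedFan d) (h : Γ.IsRestrictedSubfan F),
          IsGradedIso 𝒜 (ToricFaceRing.grading k (M.restrict h.isSubfan))) ∧
    (∀ [Algebra k A] (𝒜 : (Fin d → ℤ) → Submodule k A) [GradedAlgebra 𝒜],
      IsGradedRetractOver k 𝒜 (ToricFaceRing.grading k M) ↔
        ∃ (Γ : RationalPointedFan d) (h : Γ.IsRestrictedSubfan F),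
          IsGradedIsoOver k 𝒜 (ToricFaceRing.grading k (M.restrict h.isSubfan))) := by
  exact ⟨fun _ _ => ⟨ToricFaceRing.exists_isGradedIso_restrict,
      fun ⟨_, h, hiso⟩ => hiso.isGradedRetract (ToricFaceRing.isGradedRetract_restrict h)⟩,
    fun _ _ => ⟨ToricFaceRing.exists_isGradedIsoOver_restrict,
      fun ⟨_, h, hiso⟩ => hiso.isGradedRetractOver (ToricFaceRing.isGradedRetractOver_restrict h)⟩⟩
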